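/- \textbf{Theorem (Noninterference for DCC).} Let $(\mathcal L,\sqsubseteq)$ be a lattice. Consider the dependency core calculus without fixpoints, with booleans: the simply typed $\lambda$-calculus with types $$A,B ::= \mathsf{unit}\mid \mathsf{Bool}\mid A\times B\mid A\to B\mid T_\ell A\qquad(\ell\in\mathcal L),$$ with the usual terms for $\mathsf{unit}$, products and functions, the constants $\mathtt{tt},\mathtt{ff}:\mathsf{Bool}$, the conditional $\mathsf{if}\ M\ \mathsf{then}\ P\ \mathsf{else}\ Q : C$ (for $M:\mathsf{Bool}$ and $P,Q:C$, any type $C$), and the rules $$\frac{\Gamma\vdash M:A}{\Gamma\vdash[M]_\ell:T_\ell A}\qquad \frac{\Gamma\vdash M:T_\ell A\quad \Gamma,x:A\vdash N:B\quad B\text{ is protected at }\ell}{\Gamma\vdash \mathsf{let}\ x=M\ \mathsf{in}\ N:B}.$$ Here "protected at" is the least relation such that (I) if $\ell'\sqsubseteq\ell$ then $T_\ell A$ is protected at $\ell'$; (II) if $A$ is protected at $\ell$ then so is $T_{\ell'}A$ for every $\ell'$; (III) if $A,B$ are protected at $\ell$ then so are $A\times B$ and $C\to A$ for every type $C$. The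 equality judgement $\Gamma\vdash M=N:A$ is the least congruence on well-typed terms that contains the $\beta$ and $\eta$ equations for $\mathsf{unit}$, products and functions, the equations $(\mathsf{if}\ \mathtt{tt}\ \mathsf{then}\ P\ \mathsf{else}\ Q)=P$ and $(\mathsf{if}\ \mathtt{ff}\ \mathsf{then}\ P\ \mathsf{else}\ Q)=Q$, and the monadic equations $(\mathsf{let}\ x=[M]_\ell\ \mathsf{in}\ N)=N[M/x]$, $(\mathsf{let}\ x=M\ \mathsf{in}\ [x]_\ell)=M$ for $M:T_\ell A$, and $(\mathsf{let}\ y=(\mathsf{let}\ x=M\ \mathsf{in}\ N)\ \mathsf{in}\ P)=(\mathsf{let}\ x=M\ \mathsf{in}\ \mathsf{let}\ y=N\ \mathsf{in}\ P)$ with $x$ not free in $P$, whenever both sides are well typed. Let $A$ be a non-empty type, i.e. there is a closed term of type $A$, let $\ell,\ell'\in\mathcal L$ with $\ell\not\sqsubseteq\ell'$, and let $x:T_\ell A\vdash M:T_{\ell'}\mathsf{Bool}$. Then for all closed terms $\vdash E,E':T_\ell A$, $$\vdash M[E/x]=M[E'/x]:T_{\ell'}\mathsf{Bool}.$$ -/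

import Mathlib

namespace DCC

universe u

/-- Types of the recursion-free dependency core calculus with booleans over a set `L` of labels. -/
inductive Ty (L : Type u) : Type u
  | unit : Ty L
  | bool : Ty L
  | prod : Ty L → Ty L → Ty L
  | arrow : Ty L → Ty L → Ty L
  /-- the type `T_ℓ A` -/
  | T : L → Ty L → Ty L

/-- `Protected ℓ A`: the type `A` is protected at level `ℓ`. -/
inductive Protected {L : Type u} [LE L] : L → Ty L → Prop
  | level {ℓ ℓ' : L} {A : Ty L} : ℓ' ≤ ℓ → Protected ℓ' (Ty.T ℓ A)
  | inner {ℓ ℓ' : L} {A : Ty L} : Protected ℓ A → Protected ℓ (Ty.T ℓ' A)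
  | prod {ℓ : L} {A B : Ty L} : Protected ℓ A → Protected ℓ B → Protected ℓ (Ty.prod A B)
  | arrow {ℓ : L} {C A : Ty L} : Protected ℓ A → Protected ℓ (Ty.arrow C A)

/-- Typing contexts; the most recently bound variable comes first. -/
abbrev Ctx (L : Type u) : Type u := List (Ty L)

/-- `Var Γ A`: a (de Bruijn) variable of type `A` in the context `Γ`. -/
inductive Var {L : Type u} : Ctx L → Ty L → Type u
  | zero {Γ : Ctx L} {A : Ty L} : Var (A :: Γ) A
  | succ {Γ : Ctx L} {A B : Ty L} : Var Γ A → Var (B :: Γ) A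

/-- `Tm Γ A`: the terms `M` with `Γ ⊢ M : A`, up to renaming of bound variables. -/
inductive Tm {L : Type u} [LE L] : Ctx L → Ty L → Type u
  | var {Γ : Ctx L} {A : Ty L} : Var Γ A → Tm Γ A
  | star {Γ : Ctx L} : Tm Γ Ty.unit
  | tt {Γ : Ctx L} : Tm Γ Ty.bool
  | ff {Γ : Ctx L} : Tm Γ Ty.bool
  /-- `ite M P Q` is `if M then P else Q` -/
  | ite {Γ : Ctx L} {C : Ty L} : Tm Γ Ty.bool → Tm Γ C → Tm Γ C → Tm Γ C
  | pair {Γ : Ctx L} {A B : Ty L} : Tm Γ A → Tm Γ B → Tm Γ (Ty.prod A B)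
  | fst {Γ : Ctx L} {A B : Ty L} : Tm Γ (Ty.prod A B) → Tm Γ A
  | snd {Γ : Ctx L} {A B : Ty L} : Tm Γ (Ty.prod A B) → Tm Γ B
  | lam {Γ : Ctx L} {A B : Ty L} : Tm (A :: Γ) B → Tm Γ (Ty.arrow A B)
  | app {Γ : Ctx L} {A B : Ty L} : Tm Γ (Ty.arrow A B) → Tm Γ A → Tm Γ B
  /-- `ret ℓ M` is `[M]_ℓ` -/
  | ret {Γ : Ctx L} {A : Ty L} (ℓ : L) : Tm Γ A → Tm Γ (Ty.T ℓ A)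
  /-- `bind h M N` is `let x = M in N`, whose type has to be protected at the level of `M` -/
  | bind {Γ : Ctx L} {ℓ : L} {A B : Ty L} :
      Protected ℓ B → Tm Γ (Ty.T ℓ A) → Tm (A :: Γ) B → Tm Γ B

section Substitution

variable {L : Type u}

/-- Renamings of the variables of `Γ` by variables of `Δ`. -/
abbrev Ren (Γ Δ : Ctx L) : Type u := ∀ A : Ty L, Var Γ A → Var Δ A

/-- Extend a renaming under a binder. -/
def Ren.lift {Γ Δ : Ctx L} (ρ : Ren Γ Δ) (B : Ty L) : Ren (B :: Γ) (B :: Δ)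
  | _, Var.zero => Var.zero
  | A, Var.succ v => Var.succ (ρ A v)

variable [LE L]

def Tm.rename {Γ Δ : Ctx L} {A : Ty L} (ρ : Ren Γ Δ) : Tm Γ A → Tm Δ A
  | .var v => .var (ρ _ v)
  | .star => .star
  | .tt => .tt
  | .ff => .ff
  | .ite M P Q => .ite (M.rename ρ) (P.rename ρ) (Q.rename ρ)
  | .pair M N => .pair (M.rename ρ) (N.rename ρ)
  | .fst M => .fst (M.rename ρ)
  | .snd M => .snd (M.rename ρ)
  | .lam M => .lam (M.rename (ρ.lift _))
  | .app M N => .app (M.rename ρ) (N.rename ρ)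
  | .ret ℓ M => .ret ℓ (M.rename ρ)
  | .bind h M N => .bind h (M.rename ρ) (N.rename (ρ.lift _))

/-- The renaming that adds one fresh variable. -/
def Ren.wk {Γ : Ctx L} (B : Ty L) : Ren Γ (B :: Γ) := fun _ v => Var.succ v

/-- Weakening of a term by one fresh variable. -/
def Tm.weaken {Γ : Ctx L} {A : Ty L} (B : Ty L) (M : Tm Γ A) : Tm (B :: Γ) A :=
  M.rename (Ren.wk B)

/-- Simultaneous substitutions of terms over `Δ` for the variables of `Γ`. -/
abbrev Sub (Γ Δ : Ctx L) : Type u := ∀ A : Ty L, Var Γ A → Tm Δ A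

/-- Extend a substitution under a binder. -/
def Sub.lift {Γ Δ : Ctx L} (σ : Sub Γ Δ) (B : Ty L) : Sub (B :: Γ) (B :: Δ)
  | _, Var.zero => Tm.var Var.zero
  | A, Var.succ v => (σ A v).weaken B

/-- Simultaneous capture-avoiding substitution. -/
def Tm.subst {Γ Δ : Ctx L} {A : Ty L} (σ : Sub Γ Δ) : Tm Γ A → Tm Δ A
  | .var v => σ _ v
  | .star => .star
  | .tt => .tt
  | .ff => .ff
  | .ite M P Q => .ite (M.subst σ) (P.subst σ) (Q.subst σ)
  | .pair M N => .pair (M.subst σ) (N.subst σ)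
  | .fst M => .fst (M.subst σ)
  | .snd M => .snd (M.subst σ)
  | .lam M => .lam (M.subst (σ.lift _))
  | .app M N => .app (M.subst σ) (N.subst σ)
  | .ret ℓ M => .ret ℓ (M.subst σ)
  | .bind h M N => .bind h (M.subst σ) (N.subst (σ.lift _))

/-- The substitution `[E/x]` for the most recent variable `x`. -/
def Sub.single {Γ : Ctx L} {B : Ty L} (E : Tm Γ B) : Sub (B :: Γ) Γ
  | _, Var.zero => E
  | _, Var.succ v => Tm.var v

/-- `M.inst E` is `M[E/x]`, where `x` is the most recent variable. -/
def Tm.inst {Γ : Ctx L} {A B : Ty L} (M : Tm (B :: Γ) A) (E : Tm Γ B) : Tm Γ A :=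
  M.subst (Sub.single E)

end Substitution

/-- `TmEq M N` is the judgement `Γ ⊢ M = N : A`: the least congruence that contains the usual
equations of the simply typed lambda calculus with unit and products, the two computation rules
of the booleans, and the three equations of the monadic metalanguage. -/
inductive TmEq {L : Type u} [LE L] : {Γ : Ctx L} → {A : Ty L} → Tm Γ A → Tm Γ A → Prop
  -- equivalence relation
  | refl {Γ : Ctx L} {A : Ty L} (M : Tm Γ A) : TmEq M M
  | symm {Γ : Ctx L} {A : Ty L} {M N : Tm Γ A} : TmEq M N → TmEq N M
  | trans {Γ : Ctx L} {A : Ty L} {M N P : Tm Γ A} : TmEq M N → TmEq N P → TmEq M P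
  -- congruence
  | ite {Γ : Ctx L} {C : Ty L} {M M' : Tm Γ Ty.bool} {P P' Q Q' : Tm Γ C} :
      TmEq M M' → TmEq P P' → TmEq Q Q' → TmEq (Tm.ite M P Q) (Tm.ite M' P' Q')
  | pair {Γ : Ctx L} {A B : Ty L} {M M' : Tm Γ A} {N N' : Tm Γ B} :
      TmEq M M' → TmEq N N' → TmEq (Tm.pair M N) (Tm.pair M' N')
  | fst {Γ : Ctx L} {A B : Ty L} {M M' : Tm Γ (Ty.prod A B)} :
      TmEq M M' → TmEq (Tm.fst M) (Tm.fst M')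
  | snd {Γ : Ctx L} {A B : Ty L} {M M' : Tm Γ (Ty.prod A B)} :
      TmEq M M' → TmEq (Tm.snd M) (Tm.snd M')
  | lam {Γ : Ctx L} {A B : Ty L} {M M' : Tm (A :: Γ) B} :
      TmEq M M' → TmEq (Tm.lam M) (Tm.lam M')
  | app {Γ : Ctx L} {A B : Ty L} {M M' : Tm Γ (Ty.arrow A B)} {N N' : Tm Γ A} :
      TmEq M M' → TmEq N N' → TmEq (Tm.app M N) (Tm.app M' N')
  | ret {Γ : Ctx L} {A : Ty L} (ℓ : L) {M M' : Tm Γ A} :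
      TmEq M M' → TmEq (Tm.ret ℓ M) (Tm.ret ℓ M')
  | bind {Γ : Ctx L} {ℓ : L} {A B : Ty L} (h : Protected ℓ B)
      {M M' : Tm Γ (Ty.T ℓ A)} {N N' : Tm (A :: Γ) B} :
      TmEq M M' → TmEq N N' → TmEq (Tm.bind h M N) (Tm.bind h M' N')
  -- unit, products and functions
  | unit_eta {Γ : Ctx L} (M : Tm Γ Ty.unit) : TmEq M Tm.star
  | fst_beta {Γ : Ctx L} {A B : Ty L} (M : Tm Γ A) (N : Tm Γ B) :
      TmEq (Tm.fst (Tm.pair M N)) M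
  | snd_beta {Γ : Ctx L} {A B : Ty L} (M : Tm Γ A) (N : Tm Γ B) :
      TmEq (Tm.snd (Tm.pair M N)) N
  | pair_eta {Γ : Ctx L} {A B : Ty L} (M : Tm Γ (Ty.prod A B)) :
      TmEq (Tm.pair (Tm.fst M) (Tm.snd M)) M
  | lam_beta {Γ : Ctx L} {A B : Ty L} (M : Tm (A :: Γ) B) (N : Tm Γ A) :
      TmEq (Tm.app (Tm.lam M) N) (M.inst N)
  | lam_eta {Γ : Ctx L} {A B : Ty L} (M : Tm Γ (Ty.arrow A B)) :
      TmEq (Tm.lam (Tm.app (M.weaken A) (Tm.var Var.zero))) M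
  -- booleans
  | ite_tt {Γ : Ctx L} {C : Ty L} (P Q : Tm Γ C) : TmEq (Tm.ite Tm.tt P Q) P
  | ite_ff {Γ : Ctx L} {C : Ty L} (P Q : Tm Γ C) : TmEq (Tm.ite Tm.ff P Q) Q
  /-- `let x = [M]_ℓ in N` equals `N[M/x]` -/
  | bind_beta {Γ : Ctx L} {ℓ : L} {A B : Ty L} (h : Protected ℓ B)
      (M : Tm Γ A) (N : Tm (A :: Γ) B) :
      TmEq (Tm.bind h (Tm.ret ℓ M) N) (N.inst M)
  /-- `let x = M in [x]_ℓ` equals `M` -/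
  | bind_eta {Γ : Ctx L} {ℓ : L} {A : Ty L} (h : Protected ℓ (Ty.T ℓ A)) (M : Tm Γ (Ty.T ℓ A)) :
      TmEq (Tm.bind h M (Tm.ret ℓ (Tm.var Var.zero))) M
  /-- `let y = (let x = M in N) in P` equals `let x = M in (let y = N in P)`, provided that both
  sides are well typed -/
  | bind_assoc {Γ : Ctx L} {ℓ ℓ' : L} {A B C : Ty L} (h₁ : Protected ℓ (Ty.T ℓ' B))
      (h₂ : Protected ℓ' C) (h₃ : Protected ℓ C)
      (M : Tm Γ (Ty.T ℓ A)) (N : Tm (A :: Γ) (Ty.T ℓ' B)) (P : Tm (B :: Γ) C) :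
      TmEq (Tm.bind h₂ (Tm.bind h₁ M N) P)
        (Tm.bind h₃ M (Tm.bind h₂ N (P.rename (Ren.lift (Ren.wk A) B))))

end DCC

/-!
The proof is by a logical relation between closed terms, parametrised by the set `S` of labels an
observer may look at: at type `T_ℓ A` two terms are related if `ℓ ∈ S` implies that both are equal
to boxes `[M']_ℓ`, `[N']_ℓ` with related contents. All constructs preserve the relation for
immediate reasons, except `let` at a label outside `S`; it needs that any two closed terms of a
type protected at such a label are related.

For `S = univ` this demand is empty, so every closed term is related to itself; hence every closed
term of type `T_ℓ A` is equal to a box. With such canonical forms the demand can be verified, by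
induction on protection, for every lower set `S`. For `S = {k | k ≤ ℓ'}`, any two closed terms of
type `T_ℓ A` are then related because `ℓ ∉ S`, so they have related images under `M`, which at
type `T_ℓ' Bool` means that these images are equal.
-/

namespace DCC

section Substitution

variable {L : Type*}

theorem Ren.lift_comp_lift {Γ Δ Θ : Ctx L} (ρ : Ren Γ Δ) (ρ' : Ren Δ Θ) (B : Ty L) :
    (fun A v => ρ'.lift B A (ρ.lift B A v)) = Ren.lift (fun A v => ρ' A (ρ A v)) B := by
  funext A v
  cases v <;> rfl

variable [LE L]

theorem Sub.lift_comp_ren_lift {Γ Δ Θ : Ctx L} (ρ : Ren Γ Δ) (σ : Sub Δ Θ) (B : Ty L) :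
    (fun A v => σ.lift B A (ρ.lift B A v)) = Sub.lift (fun A v => σ A (ρ A v)) B := by
  funext A v
  cases v <;> rfl

theorem Sub.lift_var {Γ : Ctx L} (B : Ty L) :
    Sub.lift (fun A (v : Var Γ A) => Tm.var v) B = fun _ v => Tm.var v := by
  funext A v
  cases v <;> rfl

theorem Tm.rename_rename {Γ Δ Θ : Ctx L} {A : Ty L} (M : Tm Γ A) (ρ : Ren Γ Δ) (ρ' : Ren Δ Θ) :
    (M.rename ρ).rename ρ' = M.rename (fun A v => ρ' A (ρ A v)) := by
  induction M generalizing Δ Θ <;> simp only [rename, Ren.lift_comp_lift, *]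

theorem Tm.subst_rename {Γ Δ Θ : Ctx L} {A : Ty L} (M : Tm Γ A) (ρ : Ren Γ Δ) (σ : Sub Δ Θ) :
    (M.rename ρ).subst σ = M.subst (fun A v => σ A (ρ A v)) := by
  induction M generalizing Δ Θ <;> simp only [rename, subst, Sub.lift_comp_ren_lift, *]

theorem Sub.rename_lift {Γ Δ Θ : Ctx L} (σ : Sub Γ Δ) (ρ : Ren Δ Θ) (B : Ty L) :
    (fun A v => (σ.lift B A v).rename (ρ.lift B)) = Sub.lift (fun A v => (σ A v).rename ρ) B := by
  funext A v
  cases v with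
  | zero => rfl
  | succ v => exact ((σ A v).rename_rename _ _).trans ((σ A v).rename_rename ρ (Ren.wk B)).symm

theorem Tm.rename_subst {Γ Δ Θ : Ctx L} {A : Ty L} (M : Tm Γ A) (σ : Sub Γ Δ) (ρ : Ren Δ Θ) :
    (M.subst σ).rename ρ = M.subst (fun A v => (σ A v).rename ρ) := by
  induction M generalizing Δ Θ <;> simp only [rename, subst, Sub.rename_lift, *]

theorem Sub.subst_lift {Γ Δ Θ : Ctx L} (σ : Sub Γ Δ) (τ : Sub Δ Θ) (B : Ty L) :
    (fun A v => (σ.lift B A v).subst (τ.lift B)) = Sub.lift (fun A v => (σ A v).subst τ) B := by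
  funext A v
  cases v with
  | zero => rfl
  | succ v => exact ((σ A v).subst_rename _ _).trans ((σ A v).rename_subst _ _).symm

theorem Tm.subst_subst {Γ Δ Θ : Ctx L} {A : Ty L} (M : Tm Γ A) (σ : Sub Γ Δ) (τ : Sub Δ Θ) :
    (M.subst σ).subst τ = M.subst (fun A v => (σ A v).subst τ) := by
  induction M generalizing Δ Θ <;> simp only [subst, Sub.subst_lift, *]

theorem Tm.subst_var {Γ : Ctx L} {A : Ty L} (M : Tm Γ A) : M.subst (fun _ v => Tm.var v) = M := by
  induction M <;> simp only [subst, Sub.lift_var, *]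

/-- The substitution `(σ, N/x)`, where `x` is the most recent variable. -/
def Sub.cons {Γ Δ : Ctx L} {B : Ty L} (σ : Sub Γ Δ) (N : Tm Δ B) : Sub (B :: Γ) Δ
  | _, Var.zero => N
  | A, Var.succ v => σ A v

theorem Sub.subst_single_lift {Γ Δ : Ctx L} {B : Ty L} (σ : Sub Γ Δ) (N : Tm Δ B) :
    (fun A v => (σ.lift B A v).subst (Sub.single N)) = σ.cons N := by
  funext A v
  cases v with
  | zero => rfl
  | succ v => exact ((σ A v).subst_rename _ _).trans (σ A v).subst_var

theorem Tm.inst_subst_lift {Γ Δ : Ctx L} {A B : Ty L} (M : Tm (B :: Γ) A) (σ : Sub Γ Δ)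
    (N : Tm Δ B) : (M.subst (σ.lift B)).inst N = M.subst (σ.cons N) := by
  rw [inst, subst_subst, Sub.subst_single_lift]

end Substitution

variable {L : Type*} [LE L]

/-- The constant `tt` or `ff` that stands for a given boolean. -/
def Tm.ofBool {Γ : Ctx L} : Bool → Tm Γ Ty.bool
  | true => Tm.tt
  | false => Tm.ff

theorem TmEq.ite_ofBool {Γ : Ctx L} {C : Ty L} {M : Tm Γ Ty.bool} {b : Bool}
    (hM : TmEq M (Tm.ofBool b)) (P Q : Tm Γ C) : TmEq (Tm.ite M P Q) (bif b then P else Q) := by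
  refine (TmEq.ite hM (.refl P) (.refl Q)).trans ?_
  cases b
  · exact .ite_ff P Q
  · exact .ite_tt P Q

theorem TmEq.app_lam_subst {Γ Δ : Ctx L} {A B : Ty L} (M : Tm (A :: Γ) B) (σ : Sub Γ Δ)
    (N : Tm Δ A) : TmEq (Tm.app ((Tm.lam M).subst σ) N) (M.subst (σ.cons N)) := by
  rw [← Tm.inst_subst_lift]
  exact .lam_beta _ _

theorem TmEq.bind_subst {Γ Δ : Ctx L} {ℓ : L} {A B : Ty L} (hB : Protected ℓ B)
    {M : Tm Γ (Ty.T ℓ A)} {M' : Tm Δ A} (N : Tm (A :: Γ) B) (σ : Sub Γ Δ)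
    (hM : TmEq (M.subst σ) (Tm.ret ℓ M')) :
    TmEq ((Tm.bind hB M N).subst σ) (N.subst (σ.cons M')) := by
  rw [← Tm.inst_subst_lift]
  exact (TmEq.bind hB hM (.refl _)).trans (.bind_beta hB _ _)

theorem TmEq.of_fst_snd {Γ : Ctx L} {A B : Ty L} {M N : Tm Γ (Ty.prod A B)}
    (hfst : TmEq M.fst N.fst) (hsnd : TmEq M.snd N.snd) : TmEq M N :=
  (TmEq.pair_eta M).symm.trans ((TmEq.pair hfst hsnd).trans (.pair_eta N))

/-- Indistinguishability of closed terms by an observer who can open exactly the boxes whose label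
is in `S`: the logical relation of the noninterference proof. -/
def Indist (S : Set L) : (A : Ty L) → Tm [] A → Tm [] A → Prop
  | .unit, _, _ => True
  | .bool, M, N => ∃ b, TmEq M (Tm.ofBool b) ∧ TmEq N (Tm.ofBool b)
  | .prod A B, M, N => Indist S A M.fst N.fst ∧ Indist S B M.snd N.snd
  | .arrow A B, M, N => ∀ P Q, Indist S A P Q → Indist S B (M.app P) (N.app Q)
  | .T ℓ A, M, N => ℓ ∈ S →
      ∃ M' N', TmEq M (Tm.ret ℓ M') ∧ TmEq N (Tm.ret ℓ N') ∧ Indist S A M' N'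

/-- Pointwise indistinguishability of closing substitutions. -/
def IndistSub (S : Set L) {Γ : Ctx L} (σ τ : Sub Γ []) : Prop :=
  ∀ A v, Indist S A (σ A v) (τ A v)

/-- An observer with labels `S` learns nothing from types protected at a label outside `S`. This is
what the fundamental lemma `Indist.subst` requires of `S` to handle `bind`. -/
def Conceals (S : Set L) : Prop :=
  ∀ ⦃ℓ A⦄, ℓ ∉ S → Protected ℓ A → ∀ M N, Indist S A M N

/-- The first-order types whose boxes all have labels in `S`. On them, indistinguishability is
equality. -/
inductive Observable (S : Set L) : Ty L → Prop
  | unit : Observable S Ty.unit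
  | bool : Observable S Ty.bool
  | prod {A B : Ty L} : Observable S A → Observable S B → Observable S (Ty.prod A B)
  | T {ℓ : L} {A : Ty L} : ℓ ∈ S → Observable S A → Observable S (Ty.T ℓ A)

variable {S : Set L}

theorem Indist.of_tmEq {A : Ty L} {M M' N N' : Tm [] A} (hM : TmEq M M') (hN : TmEq N N')
    (h : Indist S A M' N') : Indist S A M N := by
  induction A with
  | unit => trivial
  | bool =>
    obtain ⟨b, hM', hN'⟩ := h
    exact ⟨b, hM.trans hM', hN.trans hN'⟩
  | prod A B ihA ihB => exact ⟨ihA (.fst hM) (.fst hN) h.1, ihB (.snd hM) (.snd hN) h.2⟩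
  | arrow A B _ ihB =>
    exact fun P Q hPQ => ihB (.app hM (.refl P)) (.app hN (.refl Q)) (h P Q hPQ)
  | T ℓ A _ =>
    intro hℓ
    obtain ⟨P, Q, hP, hQ, hPQ⟩ := h hℓ
    exact ⟨P, Q, hM.trans hP, hN.trans hQ, hPQ⟩

theorem Indist.tmEq {A : Ty L} {M N : Tm [] A} (h : Indist S A M N) (hA : Observable S A) :
    TmEq M N := by
  induction hA with
  | unit => exact (TmEq.unit_eta M).trans (TmEq.unit_eta N).symm
  | bool =>
    obtain ⟨b, hM, hN⟩ := h
    exact hM.trans hN.symm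
  | prod _ _ ihA ihB => exact .of_fst_snd (ihA h.1) (ihB h.2)
  | T hℓ _ ih =>
    obtain ⟨P, Q, hP, hQ, hPQ⟩ := h hℓ
    exact hP.trans ((TmEq.ret _ (ih hPQ)).trans hQ.symm)

theorem IndistSub.cons {Γ : Ctx L} {B : Ty L} {σ τ : Sub Γ []} {P Q : Tm [] B}
    (h : IndistSub S σ τ) (hPQ : Indist S B P Q) : IndistSub S (σ.cons P) (τ.cons Q)
  | _, .zero => hPQ
  | A, .succ v => h A v

theorem IndistSub.single {B : Ty L} {E E' : Tm [] B} (h : Indist S B E E') :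
    IndistSub S (Sub.single E) (Sub.single E')
  | _, .zero => h

theorem Indist.subst (hS : Conceals S) {Γ : Ctx L} {A : Ty L} (M : Tm Γ A) {σ τ : Sub Γ []}
    (h : IndistSub S σ τ) : Indist S A (M.subst σ) (M.subst τ) := by
  induction M with
  | var v => exact h _ v
  | star => trivial
  | tt => exact ⟨true, .refl _, .refl _⟩
  | ff => exact ⟨false, .refl _, .refl _⟩
  | ite M P Q ihM ihP ihQ =>
    obtain ⟨b, hσ, hτ⟩ := ihM h
    refine .of_tmEq (.ite_ofBool hσ _ _) (.ite_ofBool hτ _ _) ?_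
    cases b
    · exact ihQ h
    · exact ihP h
  | pair M N ihM ihN =>
    exact ⟨.of_tmEq (.fst_beta _ _) (.fst_beta _ _) (ihM h),
      .of_tmEq (.snd_beta _ _) (.snd_beta _ _) (ihN h)⟩
  | fst M ih => exact (ih h).1
  | snd M ih => exact (ih h).2
  | lam M ih =>
    exact fun P Q hPQ =>
      .of_tmEq (.app_lam_subst M σ P) (.app_lam_subst M τ Q) (ih (h.cons hPQ))
  | app _ N ihM ihN => exact ihM h _ _ (ihN h)
  | ret ℓ _ ih => exact fun _ => ⟨_, _, .refl _, .refl _, ih h⟩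
  | @bind _ ℓ _ _ hB M N ihM ihN =>
    by_cases hℓ : ℓ ∈ S
    · obtain ⟨P, Q, hP, hQ, hPQ⟩ := ihM h hℓ
      exact .of_tmEq (.bind_subst hB N σ hP) (.bind_subst hB N τ hQ) (ihN (h.cons hPQ))
    · exact hS hℓ hB _ _

theorem Indist.refl (hS : Conceals S) {A : Ty L} (M : Tm [] A) : Indist S A M M := by
  have h : Indist S A (M.subst fun _ v => .var v) (M.subst fun _ v => .var v) :=
    .subst hS M nofun
  rwa [Tm.subst_var] at h

theorem conceals_univ : Conceals (Set.univ : Set L) :=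
  fun _ _ hℓ => absurd (Set.mem_univ _) hℓ

theorem exists_tmEq_ret {ℓ : L} {A : Ty L} (M : Tm [] (Ty.T ℓ A)) :
    ∃ M', TmEq M (Tm.ret ℓ M') := by
  obtain ⟨M', -, hM, -⟩ := Indist.refl conceals_univ M (Set.mem_univ ℓ)
  exact ⟨M', hM⟩

theorem conceals_of_isLowerSet (hS : IsLowerSet S) : Conceals S := by
  intro ℓ A hℓ hA
  induction hA with
  | level hle => exact fun M N h => absurd (hS hle h) hℓ
  | inner _ ih =>
    intro M N _
    obtain ⟨M', hM⟩ := exists_tmEq_ret M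
    obtain ⟨N', hN⟩ := exists_tmEq_ret N
    exact ⟨M', N', hM, hN, ih hℓ M' N'⟩
  | prod _ _ ihA ihB => exact fun M N => ⟨ihA hℓ _ _, ihB hℓ _ _⟩
  | arrow _ ih => exact fun M N P Q _ => ih hℓ _ _

end DCC

theorem mainTheorem7_general {L : Type*} [LE L] {S : Set L} (hS : IsLowerSet S) {ℓ : L}
    (hℓ : ℓ ∉ S) {A B : DCC.Ty L} (hA : DCC.Protected ℓ A) (hB : DCC.Observable S B)
    (M : DCC.Tm [A] B) (E E' : DCC.Tm [] A) : DCC.TmEq (M.inst E) (M.inst E') := by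
  have conceals : DCC.Conceals S := DCC.conceals_of_isLowerSet hS
  have indist_arg : DCC.Indist S A E E' := conceals hℓ hA E E'
  have indist_inst : DCC.Indist S B (M.inst E) (M.inst E') :=
    .subst conceals M (.single indist_arg)
  exact indist_inst.tmEq hB

theorem mainTheorem7 {L : Type*} [Lattice L] (ℓ ℓ' : L) (hℓ : ¬ ℓ ≤ ℓ') (A : DCC.Ty L)
    (hA : Nonempty (DCC.Tm [] A))
    (M : DCC.Tm [DCC.Ty.T ℓ A] (DCC.Ty.T ℓ' DCC.Ty.bool))
    (E E' : DCC.Tm [] (DCC.Ty.T ℓ A)) :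
    DCC.TmEq (M.inst E) (M.inst E') := by
  exact mainTheorem7_general (isLowerSet_Iic ℓ') hℓ (.level le_rfl) (.T Set.self_mem_Iic .bool)
    M E E'
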